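/- Let $(\mathcal X, Q)$ be a probability space, $\mu$ a $\sigma$-finite measure on a measurable space $\mathcal Y$, and $T:\mathcal Y\times\mathcal X\to\mathbb R$ measurable. Let $\Theta\subset\mathbb R$ be a nondegenerate interval such that for every $\theta\in\Theta$, $\int_{\mathcal Y} e^{\theta T(y,x)}\,d\mu(y)<\infty$ for $Q$-almost every $x$. For $\theta\in\Theta$ let $$p_\theta(y\mid x)=\exp\bigl(\theta T(y,x)-A(\theta\mid x)\bigr),\qquad A(\theta\mid x)=\log\int_{\mathcal Y} e^{\theta T(y,x)}\,d\mu(y),$$ and let $P_\theta$ be the distribution of the pair $(X,Y)$ with $X\sim Q$ and $Y\mid X=x$ having density $p_\theta(\cdot\mid x)$ with respect to $\mu$ (the one-parameter conditional exponential family, or one-parameter generalized linear model). For $\alpha\in[0,1]$ and $t:\mathbb N\to[0,\infty)$, a sequence of measurable functions $\hat\theta_n:(\mathcal X\times\mathcal Y)^n\to\mathbb R$ is an $(\alpha,t(\cdot))$-estimator if for every $\theta\in\Theta$, with $Z_1,Z_2,\dots$ i.i.d. from $P_\theta$, $$\mathbb P\bigl(|\hat\theta_n(Z_1,\dots,Z_n)-\theta|\le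 t(n)\ \text{for all } n\ge 1\bigr)\ge 1-\alpha .$$ Let $\theta_0\in\Theta$, and assume that the expected conditional variance $\theta\mapsto \mathbb E\bigl[\operatorname{Var}_\theta(T(Y,X)\mid X)\bigr]$ is finite and continuous on a (relative) neighbourhood of $\theta_0$ in $\Theta$. Put $M=\mathbb E\bigl[\operatorname{Var}_{\theta_0}(T(Y,X)\mid X)\bigr]$ and assume $M>0$. Then every $(\alpha,t(\cdot))$-estimator satisfies $$t(n)\ \ge\ \frac14\sqrt{\frac{(1-\alpha)\,\log\log n}{M\,n}}\qquad\text{for infinitely many } n .$$ -/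

import Mathlib

open MeasureTheory ProbabilityTheory Filter Topology
open scoped ENNReal NNReal

/-- The sequence `est` of (measurable) estimators, `est n` being a function of the first `n`
observations, is an `(α, t(·))`-estimator of the parameter `param` over the family `P` of
distributions: if `Z₁, Z₂, …` are i.i.d. from `P i`, then with probability at least `1 - α`,
`|est n (Z₁, …, Zₙ) - param i| ≤ t n` for all `n ≥ 1` simultaneously. The sequence `Z₁, Z₂, …` is
`ω 0, ω 1, …`. -/
def IsTimeUniformEstimator {ι Z : Type*} [MeasurableSpace Z] (P : ι → Measure Z) (param : ι → ℝ)
    (α : ℝ) (t : ℕ → ℝ≥0) (est : (n : ℕ) → (Fin n → Z) → ℝ) : Prop :=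
  (∀ n, Measurable (est n)) ∧
  ∀ i, ENNReal.ofReal (1 - α) ≤ Measure.infinitePi (fun _ : ℕ => P i)
    {ω | ∀ n : ℕ, 1 ≤ n → |est n (fun k : Fin n => ω k) - param i| ≤ t n}

section GLM

variable {𝒳 𝒴 : Type*} [MeasurableSpace 𝒳] [MeasurableSpace 𝒴]

/-- The log-partition function `A(θ | x) = log ∫ exp(θ T(y, x)) dμ(y)`. -/
noncomputable def glmLogPartition (μ : Measure 𝒴) (T : 𝒴 → 𝒳 → ℝ) (θ : ℝ) (x : 𝒳) : ℝ :=
  Real.log (∫ y, Real.exp (θ * T y x) ∂μ)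

/-- The conditional density `p_θ(y | x) = exp(θ T(y, x) - A(θ | x))` with respect to `μ`. -/
noncomputable def glmDensity (μ : Measure 𝒴) (T : 𝒴 → 𝒳 → ℝ) (θ : ℝ) (y : 𝒴) (x : 𝒳) : ℝ :=
  Real.exp (θ * T y x - glmLogPartition μ T θ x)

/-- The conditional distribution `P_θ(Y ∈ · | X = x)`, with density `p_θ(· | x)`. -/
noncomputable def glmCond (μ : Measure 𝒴) (T : 𝒴 → 𝒳 → ℝ) (θ : ℝ) (x : 𝒳) : Measure 𝒴 :=
  μ.withDensity fun y => ENNReal.ofReal (glmDensity μ T θ y x)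

/-- The joint distribution `P_θ` of `(X, Y)`, where `X ∼ Q` and `Y` has the conditional density
`p_θ(· | x)` given `X = x`; that is, `P_θ` has density `(x, y) ↦ p_θ(y | x)` with respect
to `Q ⊗ μ`. -/
noncomputable def glmMeasure (Q : Measure 𝒳) (μ : Measure 𝒴) (T : 𝒴 → 𝒳 → ℝ) (θ : ℝ) :
    Measure (𝒳 × 𝒴) :=
  (Q.prod μ).withDensity fun z => ENNReal.ofReal (glmDensity μ T θ z.2 z.1)

/-- The expected conditional variance `E[Var_θ(T(Y, X) | X)]` of the sufficient statistic, as an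
extended nonnegative number. -/
noncomputable def glmExpectedCondVar (Q : Measure 𝒳) (μ : Measure 𝒴) (T : 𝒴 → 𝒳 → ℝ) (θ : ℝ) :
    ℝ≥0∞ :=
  ∫⁻ x, evariance (fun y => T y x) (glmCond μ T θ x) ∂Q

theorem measurable_glmDensity (μ : Measure 𝒴) [SigmaFinite μ] {T : 𝒴 → 𝒳 → ℝ}
    (hT : Measurable (Function.uncurry T)) (θ : ℝ) :
    Measurable fun z : 𝒳 × 𝒴 => ENNReal.ofReal (glmDensity μ T θ z.2 z.1) := by
  have hT' : Measurable fun z : 𝒳 × 𝒴 => T z.2 z.1 := hT.comp measurable_swap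
  have hA : Measurable fun x : 𝒳 => glmLogPartition μ T θ x := by
    refine Real.measurable_log.comp ?_
    have h : StronglyMeasurable fun z : 𝒳 × 𝒴 => Real.exp (θ * T z.2 z.1) :=
      (Real.measurable_exp.comp (hT'.const_mul θ)).stronglyMeasurable
    exact (h.integral_prod_right (ν := μ)).measurable
  exact (Real.measurable_exp.comp ((hT'.const_mul θ).sub (hA.comp measurable_fst))).ennreal_ofReal

/-- `glmMeasure` is the joint law with `X ∼ Q` and conditional laws `glmCond`. -/
theorem glmMeasure_prod (Q : Measure 𝒳) [IsProbabilityMeasure Q] (μ : Measure 𝒴) [SigmaFinite μ]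
    {T : 𝒴 → 𝒳 → ℝ} (hT : Measurable (Function.uncurry T)) (θ : ℝ) {s : Set 𝒳} {u : Set 𝒴}
    (hs : MeasurableSet s) (hu : MeasurableSet u) :
    glmMeasure Q μ T θ (s ×ˢ u) = ∫⁻ x in s, glmCond μ T θ x u ∂Q := by
  rw [glmMeasure, withDensity_apply _ (hs.prod hu), ← Measure.prod_restrict,
    lintegral_prod _ (measurable_glmDensity μ hT θ).aemeasurable]
  simp only [glmCond, withDensity_apply _ hu]

end GLM

/-- `glmCond` is a probability measure wherever the log-partition function is a genuine one. -/
theorem isProbabilityMeasure_glmCond {𝒳 𝒴 : Type*} [MeasurableSpace 𝒴]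
    (μ : Measure 𝒴) (hμ : μ ≠ 0) (T : 𝒴 → 𝒳 → ℝ) (θ : ℝ)
    (x : 𝒳)
    (h : Integrable (fun y => Real.exp (θ * T y x)) μ) :
    IsProbabilityMeasure (glmCond μ T θ x) := by
  have : NeZero μ := ⟨hμ⟩
  have hpos : 0 < ∫ y, Real.exp (θ * T y x) ∂μ := integral_exp_pos h
  constructor
  rw [glmCond, withDensity_apply _ MeasurableSet.univ, Measure.restrict_univ,
    ← ofReal_integral_eq_lintegral_ofReal]
  · simp only [glmDensity, glmLogPartition, Real.exp_sub, Real.exp_log hpos, integral_div]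
    rw [div_self hpos.ne', ENNReal.ofReal_one]
  · simp only [glmDensity, Real.exp_sub]
    exact h.div_const _
  · exact ae_of_all _ fun y => (Real.exp_pos _).le

/-! The proof packs infinitely many well-separated parameters next to `θ₀`, one per geometric time.
Put `n_k = 64 ^ k`, let `s_k` be the radius `√((1 - α) log log n_k / (M n_k))`, and suppose `t (n_k)
< s_k / 4` for all large `k`. The parameters `θ_k = θ₀ ± (3/4) s_k` are then so far apart that the
events `B_k`, "the estimates at times `n_i`, `i ≤ k`, are compatible with `θ_k`", are pairwise
disjoint, although each has probability at least `1 - α` under its own `θ_k`.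

Disjointness bounds the sum of the probabilities of the `B_k` under one common reference law by `1`
(`sum_exp_le_one_of_separated`). In the other direction, `B_k` depends on `n_k` observations only,
so an entropy inequality (`pi_real_mul_log_le`, `ofReal_exp_le_pi`) bounds its reference probability
below by `exp (-(n_k κ_k + 1) / (1 - α))`, where `κ_k` bounds the relative entropy per observation.

In the model this entropy is at most the squared parameter distance times the largest expected
conditional variance in between (`integral_glmLogLikelihood_le`). By continuity that variance is at
most `3 M / 2` near `θ₀`, so the exponent is `-(27/32) log log n_k` up to a constant. The
probabilities thus dominate a multiple of `1 / log n_k`, that is, of `1 / k`, and the divergence of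
the harmonic series is the contradiction. -/

/-! ### Product laws and change of measure -/

/-- A finite product of measures with densities has the product density. -/
theorem pi_withDensity_eq_withDensity_prod {ι Z : Type*} [Fintype ι] [MeasurableSpace Z]
    (P : Measure Z) [IsProbabilityMeasure P] {f : Z → ℝ≥0∞} (hf : Measurable f)
    [SigmaFinite (P.withDensity f)] :
    Measure.pi (fun _ : ι => P.withDensity f)
      = (Measure.pi fun _ : ι => P).withDensity fun z => ∏ i, f (z i) := by
  classical
  refine Measure.pi_eq fun s hs => ?_
  rw [withDensity_apply _ (MeasurableSet.univ_pi hs), ← lintegral_indicator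
    (MeasurableSet.univ_pi hs)]
  have h : (Set.univ.pi s).indicator (fun z : ι → Z => ∏ i, f (z i))
      = fun z => ∏ i, (s i).indicator f (z i) := by
    funext z
    by_cases hz : z ∈ Set.univ.pi s
    · rw [Set.indicator_of_mem hz]
      exact Finset.prod_congr rfl fun i _ => (Set.indicator_of_mem (hz i trivial) f).symm
    · rw [Set.indicator_of_notMem hz]
      obtain ⟨i, hi⟩ : ∃ i, z i ∉ s i := by simpa [Set.mem_pi] using hz
      exact (Finset.prod_eq_zero (Finset.mem_univ i) (Set.indicator_of_notMem hi f)).symm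
  have hm : ∀ i, Measurable ((s i).indicator f) := fun i => hf.indicator (hs i)
  have hind : iIndepFun (fun i (z : ι → Z) => (s i).indicator f (z i))
      (Measure.pi fun _ : ι => P) :=
    iIndepFun_pi (X := fun i => (s i).indicator f) fun i => (hm i).aemeasurable
  rw [h, lintegral_prod_eq_prod_lintegral_of_indepFun Finset.univ _ hind
    fun i => (hm i).comp (measurable_pi_apply i)]
  refine Finset.prod_congr rfl fun i _ => ?_
  rw [(measurePreserving_eval (fun _ : ι => P) i).lintegral_comp (hm i),
    lintegral_indicator (hs i), withDensity_apply _ (hs i)]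

/-- The law of the first `n` coordinates of an i.i.d. sequence is a finite product measure. -/
theorem infinitePi_map_fin {Z : Type*} [MeasurableSpace Z] (P : Measure Z)
    [IsProbabilityMeasure P] (n : ℕ) :
    (Measure.infinitePi fun _ : ℕ => P).map (fun ω (k : Fin n) => ω k)
      = Measure.pi fun _ : Fin n => P := by
  symm
  refine Measure.pi_eq fun s hs => ?_
  rw [Measure.map_apply (by fun_prop) (MeasurableSet.univ_pi hs)]
  let s' : ℕ → Set Z := fun k => if h : k < n then s ⟨k, h⟩ else Set.univ
  have h : (fun (ω : ℕ → Z) (k : Fin n) => ω k) ⁻¹' Set.univ.pi s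
      = Set.pi (Finset.range n : Set ℕ) s' := by
    ext ω
    simp only [Set.mem_preimage, Set.mem_pi, Set.mem_univ, forall_const, Finset.coe_range,
      Set.mem_Iio, s']
    exact ⟨fun H k hk => by simpa [hk] using H ⟨k, hk⟩, fun H k => by simpa using H k k.2⟩
  rw [h, Measure.infinitePi_pi]
  · rw [Finset.prod_range]
    simp [s']
  · intro k _
    simp only [s']
    split_ifs
    exacts [hs _, MeasurableSet.univ]

/-- Change of measure for a product: an event of small probability `q` under `P₀ⁿ` has a
probability under `Pⁿ` that is controlled by the expected log-likelihood ratio. -/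
theorem pi_real_mul_log_le {Z : Type*} [MeasurableSpace Z] {P P₀ : Measure Z}
    [IsProbabilityMeasure P] [IsProbabilityMeasure P₀] {l : Z → ℝ} (hl : Measurable l)
    (hP : P₀ = P.withDensity fun z => ENNReal.ofReal (Real.exp (-l z)))
    (hint : Integrable l P) {κ : ℝ} (hκ : ∫ z, l z ∂P ≤ κ) (n : ℕ) {A : Set (Fin n → Z)}
    (hA : MeasurableSet A) {q : ℝ} (hq : 0 < q)
    (hAq : Measure.pi (fun _ : Fin n => P₀) A ≤ ENNReal.ofReal q) :
    (Measure.pi fun _ : Fin n => P).real A * Real.log (1 / q) ≤ n * κ + Real.log 2 := by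
  set ρ : Measure (Fin n → Z) := Measure.pi fun _ : Fin n => P with hρ
  set L : (Fin n → Z) → ℝ := fun z => ∑ i, l (z i) with hL
  have hLm : Measurable L := Finset.measurable_sum _ fun i _ => hl.comp (measurable_pi_apply i)
  have hρ₀ : Measure.pi (fun _ : Fin n => P₀)
      = ρ.withDensity fun z => ENNReal.ofReal (Real.exp (-L z)) := by
    subst hP
    rw [pi_withDensity_eq_withDensity_prod P (by fun_prop)]
    congr 1
    funext z
    rw [← ENNReal.ofReal_prod_of_nonneg fun i _ => (Real.exp_pos _).le, ← Real.exp_sum,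
      Finset.sum_neg_distrib]
  have hint' : ∀ i : Fin n, Integrable (fun z : Fin n → Z => l (z i)) ρ := fun i =>
    (measurePreserving_eval (fun _ : Fin n => P) i).integrable_comp_of_integrable hint
  have hLint : Integrable L ρ := integrable_finsetSum _ fun i _ => hint' i
  have hLκ : ∫ z, L z ∂ρ ≤ n * κ := by
    rw [hL, integral_finsetSum _ fun i _ => hint' i]
    have : ∀ i : Fin n, ∫ z : Fin n → Z, l (z i) ∂ρ = ∫ z, l z ∂P := fun i => by
      have h := integral_map (μ := ρ) (φ := fun z : Fin n → Z => z i)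
        (measurable_pi_apply i).aemeasurable (f := l) hl.aestronglyMeasurable
      rw [← h, show ρ.map (fun z : Fin n → Z => z i) = P from
        (measurePreserving_eval (fun _ : Fin n => P) i).map_eq]
    simp only [this, Finset.sum_const, Finset.card_univ, Fintype.card_fin, nsmul_eq_mul]
    gcongr
  -- the exponential moment of `log (1/q) 1_A - L`
  set g : (Fin n → Z) → ℝ := A.indicator fun _ => Real.log (1 / q) with hg
  have hgm : Measurable g := measurable_const.indicator hA
  have hexp : ∫⁻ z, ENNReal.ofReal (Real.exp (g z - L z)) ∂ρ ≤ 2 := by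
    have h1 : ∀ z, ENNReal.ofReal (Real.exp (g z - L z))
        = ENNReal.ofReal (Real.exp (-L z)) * ENNReal.ofReal (Real.exp (g z)) := fun z => by
      rw [← ENNReal.ofReal_mul (Real.exp_pos _).le, ← Real.exp_add]
      ring_nf
    simp only [h1]
    have h2 := lintegral_withDensity_eq_lintegral_mul ρ
      (f := fun z => ENNReal.ofReal (Real.exp (-L z))) (by fun_prop)
      (g := fun z => ENNReal.ofReal (Real.exp (g z))) (by fun_prop)
    simp only [Pi.mul_apply] at h2
    -- Passing to the law `P₀ⁿ` absorbs `exp (-L)`. There `exp g` is `1 / q` on `A`, whose mass is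
    -- at most `q`, and `1` off `A`: each part contributes at most `1`.
    rw [← h2, ← hρ₀, ← lintegral_add_compl _ hA]
    have h3 : ∫⁻ z in A, ENNReal.ofReal (Real.exp (g z)) ∂(Measure.pi fun _ : Fin n => P₀) ≤ 1 := by
      rw [setLIntegral_congr_fun (g := fun _ => ENNReal.ofReal (1 / q)) hA
        (fun z hz => by simp only [hg, Set.indicator_of_mem hz, Real.exp_log (one_div_pos.2 hq)]),
        setLIntegral_const]
      calc _ ≤ ENNReal.ofReal (1 / q) * ENNReal.ofReal q := by gcongr
        _ = 1 := by rw [← ENNReal.ofReal_mul (by positivity), one_div_mul_cancel hq.ne',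
              ENNReal.ofReal_one]
    have h4 : ∫⁻ z in Aᶜ, ENNReal.ofReal (Real.exp (g z)) ∂(Measure.pi fun _ : Fin n => P₀)
        ≤ 1 := by
      rw [setLIntegral_congr_fun (g := fun _ => 1) hA.compl
        (fun z hz => by simp [hg, Set.indicator_of_notMem hz]), setLIntegral_const, one_mul]
      exact prob_le_one
    calc _ ≤ (1 : ℝ≥0∞) + 1 := add_le_add h3 h4
      _ = 2 := one_add_one_eq_two
  have hexpint : Integrable (fun z => Real.exp (g z - L z)) ρ := by
    refine ⟨by fun_prop, ?_⟩
    rw [hasFiniteIntegral_iff_ofReal (ae_of_all _ fun z => (Real.exp_pos _).le)]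
    exact hexp.trans_lt (by simp)
  have hexp' : ∫ z, Real.exp (g z - L z) ∂ρ ≤ 2 := by
    rw [integral_eq_lintegral_of_nonneg_ae (ae_of_all _ fun z => (Real.exp_pos _).le)
      hexpint.aestronglyMeasurable]
    exact ENNReal.toReal_le_of_le_ofReal (by norm_num) (by simpa using hexp)
  have hgint : Integrable g ρ := (integrable_const _).indicator hA
  -- Jensen's inequality by hand: this is `log w ≤ w / 2 + log 2 - 1`, the tangent to the logarithm
  -- at `2`, with `w = exp (g z - L z)`, whose mean is at most `2`.
  have hpt : ∀ z, g z - L z ≤ Real.exp (g z - L z) / 2 + (Real.log 2 - 1) := fun z => by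
    have h := Real.add_one_le_exp (g z - L z - Real.log 2)
    rw [Real.exp_sub _ (Real.log 2), Real.exp_log two_pos] at h
    linarith
  have hmain := integral_mono (hgint.sub hLint)
    ((hexpint.div_const 2).add (integrable_const (Real.log 2 - 1))) hpt
  rw [integral_add' (hexpint.div_const 2) (integrable_const _), integral_sub' hgint hLint,
    integral_div, integral_const, hg, integral_indicator_const _ hA] at hmain
  simp only [probReal_univ, smul_eq_mul, one_mul] at hmain
  linarith

/-! ### Relative entropy in an exponential family -/

section CGF

variable {Ω : Type*} [MeasurableSpace Ω] {μ : Measure Ω} {X : Ω → ℝ} {s t : ℝ}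

theorem isProbabilityMeasure_tilted_mul (hμ : μ ≠ 0) (ht : t ∈ integrableExpSet X μ) :
    IsProbabilityMeasure (μ.tilted (t * X ·)) := by
  have : NeZero μ := ⟨hμ⟩
  exact isProbabilityMeasure_tilted ht

/-- The density at `t` times the inverse likelihood ratio is the density at `s`; the cumulant terms
at `t` cancel. -/
theorem exp_mul_sub_cgf_mul_exp (s t c : ℝ) :
    Real.exp (t * c - cgf X μ t) * Real.exp (-((t - s) * c - cgf X μ t + cgf X μ s))
      = Real.exp (s * c) / Real.exp (cgf X μ s) := by
  rw [← Real.exp_add, ← Real.exp_sub]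
  ring_nf

/-- The likelihood ratio between two members of an exponential family is integrable. -/
theorem integrable_exp_neg_tilted (hμ : μ ≠ 0) (hs : s ∈ integrableExpSet X μ)
    (ht : t ∈ integrableExpSet X μ) :
    Integrable (fun ω => Real.exp (-((t - s) * X ω - cgf X μ t + cgf X μ s)))
      (μ.tilted (t * X ·)) := by
  have : NeZero μ := ⟨hμ⟩
  rw [integrable_tilted_iff ht]
  have h : (fun ω => Real.exp (t * X ω) • Real.exp (-((t - s) * X ω - cgf X μ t + cgf X μ s)))
      = fun ω => Real.exp (s * X ω) * (Real.exp (cgf X μ t) / Real.exp (cgf X μ s)) := by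
    funext ω
    have h := exp_mul_sub_cgf_mul_exp (X := X) (μ := μ) s t (X ω)
    rw [Real.exp_sub, div_mul_eq_mul_div, div_eq_iff (Real.exp_pos _).ne'] at h
    rw [smul_eq_mul, h]
    ring
  rw [h]
  exact Integrable.mul_const hs _

/-- The likelihood ratio between two members of an exponential family has mean one. -/
theorem integral_exp_neg_tilted (hμ : μ ≠ 0) (hs : s ∈ integrableExpSet X μ)
    (ht : t ∈ integrableExpSet X μ) :
    ∫ ω, Real.exp (-((t - s) * X ω - cgf X μ t + cgf X μ s)) ∂(μ.tilted (t * X ·)) = 1 := by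
  have : NeZero μ := ⟨hμ⟩
  simp only [integral_tilted_mul_eq_cgf _ ht, smul_eq_mul, exp_mul_sub_cgf_mul_exp, integral_div]
  rw [exp_cgf hs, mgf, div_self]
  exact (integral_exp_pos hs).ne'

theorem integrable_logLikelihood_tilted (hμ : μ ≠ 0) (ht : t ∈ interior (integrableExpSet X μ)) :
    Integrable (fun ω => (t - s) * X ω - cgf X μ t + cgf X μ s) (μ.tilted (t * X ·)) := by
  have : NeZero μ := ⟨hμ⟩
  have := isProbabilityMeasure_tilted_mul hμ (interior_subset ht)
  exact ((((memLp_tilted_mul ht 1).integrable le_rfl).const_mul _).sub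
    (integrable_const _)).add (integrable_const _)

theorem integral_logLikelihood_tilted (hμ : μ ≠ 0) (ht : t ∈ interior (integrableExpSet X μ)) :
    ∫ ω, ((t - s) * X ω - cgf X μ t + cgf X μ s) ∂(μ.tilted (t * X ·))
      = (t - s) * deriv (cgf X μ) t - cgf X μ t + cgf X μ s := by
  have : NeZero μ := ⟨hμ⟩
  have := isProbabilityMeasure_tilted_mul hμ (interior_subset ht)
  have hX := ((memLp_tilted_mul ht 1).integrable le_rfl).const_mul (t - s)
  have hX' := hX.sub (integrable_const (cgf X μ t))
  simp only [Pi.sub_def] at hX'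
  rw [integral_add hX' (integrable_const _),
    integral_sub hX (integrable_const _), integral_const_mul, integral_tilted_mul_self ht]
  simp

/-- Nonnegativity of the relative entropy between members of an exponential family. -/
theorem logLikelihood_nonneg (hμ : μ ≠ 0) (hs : s ∈ integrableExpSet X μ)
    (ht : t ∈ interior (integrableExpSet X μ)) :
    0 ≤ (t - s) * deriv (cgf X μ) t - cgf X μ t + cgf X μ s := by
  have : NeZero μ := ⟨hμ⟩
  have := isProbabilityMeasure_tilted_mul hμ (interior_subset ht)
  have hl := integrable_logLikelihood_tilted (s := s) hμ ht
  have h := integral_mono (hl.neg.add (integrable_const 1))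
    (integrable_exp_neg_tilted hμ hs (interior_subset ht)) fun ω => Real.add_one_le_exp _
  rw [integral_exp_neg_tilted hμ hs (interior_subset ht), integral_add' hl.neg (integrable_const _),
    integral_neg', integral_logLikelihood_tilted hμ ht] at h
  simp only [integral_const, probReal_univ, smul_eq_mul, one_mul] at h
  linarith

/-- The curvature of the cumulant function is the variance under the tilted law. The form in `[0,
∞]` permits Tonelli's theorem over parameter and covariate later. -/
theorem evariance_tilted_mul (hμ : μ ≠ 0) (ht : t ∈ interior (integrableExpSet X μ)) :
    evariance X (μ.tilted (t * X ·)) = ‖iteratedDeriv 2 (cgf X μ) t‖ₑ := by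
  have : NeZero μ := ⟨hμ⟩
  have := isProbabilityMeasure_tilted_mul hμ (interior_subset ht)
  rw [← variance_tilted_mul ht, Real.enorm_eq_ofReal (variance_nonneg _ _),
    (memLp_tilted_mul ht 2).ofReal_variance_eq]

/-- The relative entropy between two members of an exponential family is at most their parameter
distance times the integral of the variance function between them. -/
theorem lintegral_logLikelihood_tilted_le (hμ : μ ≠ 0)
    (hst : Set.uIcc s t ⊆ interior (integrableExpSet X μ)) :
    ∫⁻ ω, ENNReal.ofReal (((t - s) * X ω - cgf X μ t + cgf X μ s)
        + Real.exp (-((t - s) * X ω - cgf X μ t + cgf X μ s)) - 1) ∂(μ.tilted (t * X ·))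
      ≤ ENNReal.ofReal |t - s| * ∫⁻ u in Set.uIoc s t, evariance X (μ.tilted (u * X ·)) := by
  have hs := hst Set.left_mem_uIcc
  have ht := hst Set.right_mem_uIcc
  have : NeZero μ := ⟨hμ⟩
  have := isProbabilityMeasure_tilted_mul hμ (interior_subset ht)
  have hl := integrable_logLikelihood_tilted (s := s) hμ ht
  have he := integrable_exp_neg_tilted hμ (interior_subset hs) (interior_subset ht)
  have hle := hl.add he
  simp only [Pi.add_def] at hle
  have hφ := hle.sub (integrable_const 1)
  simp only [Pi.sub_def] at hφ
  rw [← ofReal_integral_eq_lintegral_ofReal hφ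
    (ae_of_all _ fun ω => by
      have := Real.add_one_le_exp (-((t - s) * X ω - cgf X μ t + cgf X μ s))
      simp only [Pi.zero_apply]
      linarith)]
  rw [integral_sub hle (integrable_const 1), integral_add hl he,
    integral_exp_neg_tilted hμ (interior_subset hs) (interior_subset ht),
    integral_logLikelihood_tilted hμ ht, integral_const, probReal_univ, one_smul]
  -- This is the relative entropy with the two roles exchanged. Adding it to the original one gives
  -- `(t - s) * (A' t - A' s)`, with `A` the cumulant function, which depends only on the second
  -- derivative.
  have hst' := logLikelihood_nonneg hμ (interior_subset ht) hs
  have hderiv : ∀ u ∈ Set.uIcc s t,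
      HasDerivAt (deriv (cgf X μ)) (iteratedDeriv 2 (cgf X μ) u) u := fun u hu => by
    rw [iteratedDeriv_succ, iteratedDeriv_one]
    exact (analyticAt_cgf (hst hu)).deriv.differentiableAt.hasDerivAt
  have hcont : ContinuousOn (iteratedDeriv 2 (cgf X μ)) (Set.uIcc s t) := fun u hu => by
    rw [iteratedDeriv_succ, iteratedDeriv_one]
    exact (analyticAt_cgf (hst hu)).deriv.deriv.continuousAt.continuousWithinAt
  have hftc := intervalIntegral.integral_eq_sub_of_hasDerivAt hderiv hcont.intervalIntegrable
  have hnorm := intervalIntegral.norm_integral_le_integral_norm_uIoc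
    (f := iteratedDeriv 2 (cgf X μ)) (a := s) (b := t) (μ := volume)
  have hbound : (t - s) * deriv (cgf X μ) t - cgf X μ t + cgf X μ s + 1 - 1
      ≤ |t - s| * ∫ u in Set.uIoc s t, ‖iteratedDeriv 2 (cgf X μ) u‖ := by
    calc _ ≤ (t - s) * (deriv (cgf X μ) t - deriv (cgf X μ) s) := by linarith
      _ ≤ |(t - s) * (deriv (cgf X μ) t - deriv (cgf X μ) s)| := le_abs_self _
      _ = |t - s| * ‖deriv (cgf X μ) t - deriv (cgf X μ) s‖ := abs_mul _ _
      _ ≤ _ := by rw [← hftc]; gcongr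
  refine (ENNReal.ofReal_le_ofReal hbound).trans ?_
  rw [ENNReal.ofReal_mul (abs_nonneg _), ofReal_integral_norm_eq_lintegral_enorm
    (intervalIntegrable_iff.1 hcont.intervalIntegrable)]
  gcongr ENNReal.ofReal |t - s| * ?_
  refine le_of_eq (setLIntegral_congr_fun measurableSet_uIoc fun u hu => ?_)
  exact (evariance_tilted_mul hμ (hst (Set.uIoc_subset_uIcc hu))).symm

end CGF

/-! ### The conditional model: averaging over the covariate -/

/-- Transfers the cumulant results to the model. Integrability makes the partition integral
positive, so that `exp (log ·)` returns it rather than a default value. -/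
theorem glmCond_eq_tilted {𝒳 𝒴 : Type*} [MeasurableSpace 𝒴] {μ : Measure 𝒴} (hμ : μ ≠ 0)
    {T : 𝒴 → 𝒳 → ℝ} {θ : ℝ} {x : 𝒳}
    (h : Integrable (fun y => Real.exp (θ * T y x)) μ) :
    glmCond μ T θ x = μ.tilted fun y => θ * T y x := by
  have : NeZero μ := ⟨hμ⟩
  simp only [glmCond, glmDensity, glmLogPartition, Measure.tilted, Real.exp_sub,
    Real.exp_log (integral_exp_pos h)]

section GLM

variable {𝒳 𝒴 : Type*} [MeasurableSpace 𝒳] [MeasurableSpace 𝒴]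

theorem measurable_glmLogPartition (μ : Measure 𝒴) [SigmaFinite μ] {T : 𝒴 → 𝒳 → ℝ}
    (hT : Measurable (Function.uncurry T)) :
    Measurable fun z : ℝ × 𝒳 => glmLogPartition μ T z.1 z.2 := by
  have hT' : Measurable fun z : (ℝ × 𝒳) × 𝒴 => T z.2 z.1.2 :=
    hT.comp (measurable_snd.prodMk (measurable_snd.comp measurable_fst))
  have h : StronglyMeasurable fun z : (ℝ × 𝒳) × 𝒴 => Real.exp (z.1.1 * T z.2 z.1.2) :=
    (Real.measurable_exp.comp ((measurable_fst.comp measurable_fst).mul hT')).stronglyMeasurable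
  exact Real.measurable_log.comp (h.integral_prod_right (ν := μ)).measurable

/-- The conditional variance is jointly measurable in the parameter and the covariate. -/
theorem measurable_evariance_glmCond (μ : Measure 𝒴) [SigmaFinite μ] {T : 𝒴 → 𝒳 → ℝ}
    (hT : Measurable (Function.uncurry T)) :
    Measurable fun z : ℝ × 𝒳 => evariance (fun y => T y z.2) (glmCond μ T z.1 z.2) := by
  have hT' : Measurable fun z : (ℝ × 𝒳) × 𝒴 => T z.2 z.1.2 :=
    hT.comp (measurable_snd.prodMk (measurable_snd.comp measurable_fst))
  have hp : Measurable fun z : (ℝ × 𝒳) × 𝒴 => glmDensity μ T z.1.1 z.2 z.1.2 :=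
    Real.measurable_exp.comp (((measurable_fst.comp measurable_fst).mul hT').sub
      ((measurable_glmLogPartition μ hT).comp measurable_fst))
  have hp' : ∀ z : ℝ × 𝒳, Measurable fun y => glmDensity μ T z.1 y z.2 := fun z =>
    hp.comp measurable_prodMk_left
  have hTx : ∀ x, Measurable fun y => T y x := fun x => hT.comp measurable_prodMk_right
  have hm : Measurable fun z : ℝ × 𝒳 => ∫ y, T y z.2 ∂(glmCond μ T z.1 z.2) := by
    have h : StronglyMeasurable fun z : (ℝ × 𝒳) × 𝒴 =>
      (ENNReal.ofReal (glmDensity μ T z.1.1 z.2 z.1.2)).toReal • T z.2 z.1.2 :=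
      (hp.ennreal_ofReal.ennreal_toReal.smul hT').stronglyMeasurable
    convert (h.integral_prod_right' (ν := μ)).measurable using 2 with z
    rw [glmCond, integral_withDensity_eq_integral_toReal_smul (hp' z).ennreal_ofReal
      (ae_of_all _ fun _ => ENNReal.ofReal_lt_top)]
  have h : Measurable fun z : (ℝ × 𝒳) × 𝒴 => ENNReal.ofReal (glmDensity μ T z.1.1 z.2 z.1.2)
      * ‖T z.2 z.1.2 - ∫ y, T y z.1.2 ∂(glmCond μ T z.1.1 z.1.2)‖ₑ ^ 2 :=
    hp.ennreal_ofReal.mul ((hT'.sub (hm.comp measurable_fst)).enorm.pow_const 2)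
  convert h.lintegral_prod_right' (ν := μ) using 2 with z
  rw [evariance]
  nth_rewrite 1 [glmCond]
  rw [lintegral_withDensity_eq_lintegral_mul _ (hp' z).ennreal_ofReal
    (((hTx z.2).sub_const _).enorm.pow_const 2)]
  rfl

theorem lintegral_glmMeasure (Q : Measure 𝒳) [IsProbabilityMeasure Q] (μ : Measure 𝒴)
    [SigmaFinite μ] {T : 𝒴 → 𝒳 → ℝ} (hT : Measurable (Function.uncurry T)) (θ : ℝ)
    {f : 𝒳 × 𝒴 → ℝ≥0∞} (hf : Measurable f) :
    ∫⁻ z, f z ∂(glmMeasure Q μ T θ) = ∫⁻ x, ∫⁻ y, f (x, y) ∂(glmCond μ T θ x) ∂Q := by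
  have hp := measurable_glmDensity μ hT θ
  rw [glmMeasure, lintegral_withDensity_eq_lintegral_mul _ hp hf,
    lintegral_prod _ (hp.mul hf).aemeasurable]
  refine lintegral_congr fun x => ?_
  rw [glmCond, lintegral_withDensity_eq_lintegral_mul _
    (f := fun y => ENNReal.ofReal (glmDensity μ T θ y x)) (hp.comp measurable_prodMk_left)
    (g := fun y => f (x, y)) (hf.comp measurable_prodMk_left)]
  rfl

theorem isProbabilityMeasure_glmMeasure (Q : Measure 𝒳) [IsProbabilityMeasure Q] (μ : Measure 𝒴)
    [SigmaFinite μ] (hμ : μ ≠ 0) {T : 𝒴 → 𝒳 → ℝ} (hT : Measurable (Function.uncurry T)) {θ : ℝ}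
    (h : ∀ᵐ x ∂Q, Integrable (fun y => Real.exp (θ * T y x)) μ) :
    IsProbabilityMeasure (glmMeasure Q μ T θ) := by
  constructor
  rw [← Set.univ_prod_univ, glmMeasure_prod Q μ hT θ .univ .univ, Measure.restrict_univ]
  have h' : ∀ᵐ x ∂Q, glmCond μ T θ x Set.univ = 1 := by
    filter_upwards [h] with x hx
    exact (isProbabilityMeasure_glmCond μ hμ T θ x hx).measure_univ
  rw [lintegral_congr_ae h', lintegral_one, measure_univ]

/-- The log-likelihood ratio `log (p_θ / p_s)` at one observation. -/
noncomputable def glmLogLikelihood (μ : Measure 𝒴) (T : 𝒴 → 𝒳 → ℝ) (s θ : ℝ) (z : 𝒳 × 𝒴) : ℝ :=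
  (θ - s) * T z.2 z.1 - glmLogPartition μ T θ z.1 + glmLogPartition μ T s z.1

theorem measurable_glmLogLikelihood (μ : Measure 𝒴) [SigmaFinite μ] {T : 𝒴 → 𝒳 → ℝ}
    (hT : Measurable (Function.uncurry T)) (s θ : ℝ) :
    Measurable (glmLogLikelihood μ T s θ) := by
  have hA : ∀ θ, Measurable fun z : 𝒳 × 𝒴 => glmLogPartition μ T θ z.1 := fun θ =>
    (measurable_glmLogPartition μ hT).comp (measurable_const.prodMk measurable_fst)
  exact (((hT.comp measurable_swap).const_mul (θ - s)).sub (hA θ)).add (hA s)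

/-- The log-partition terms at `θ` cancel pointwise, so the identity needs no integrability, even at
covariates where the partition function is a default value. -/
theorem glmMeasure_eq_withDensity (Q : Measure 𝒳) (μ : Measure 𝒴) [SigmaFinite μ]
    {T : 𝒴 → 𝒳 → ℝ} (hT : Measurable (Function.uncurry T)) (s θ : ℝ) :
    glmMeasure Q μ T s = (glmMeasure Q μ T θ).withDensity fun z =>
      ENNReal.ofReal (Real.exp (-glmLogLikelihood μ T s θ z)) := by
  have hl := measurable_glmLogLikelihood μ hT s θ
  rw [glmMeasure, glmMeasure, ← withDensity_mul _ (measurable_glmDensity μ hT θ) (by fun_prop)]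
  congr 1
  funext z
  rw [Pi.mul_apply, glmDensity, glmDensity, ← ENNReal.ofReal_mul (Real.exp_pos _).le,
    ← Real.exp_add, glmLogLikelihood]
  ring_nf

/-- A bound on the relative entropy of two members of the model, in the form of a lower Lebesgue
integral of a nonnegative function. -/
theorem lintegral_glmLogLikelihood_le (Q : Measure 𝒳) [IsProbabilityMeasure Q] (μ : Measure 𝒴)
    [SigmaFinite μ] (hμ : μ ≠ 0) {T : 𝒴 → 𝒳 → ℝ} (hT : Measurable (Function.uncurry T))
    {a b s θ : ℝ} (ha : ∀ᵐ x ∂Q, Integrable (fun y => Real.exp (a * T y x)) μ)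
    (hb : ∀ᵐ x ∂Q, Integrable (fun y => Real.exp (b * T y x)) μ)
    (hs : s ∈ Set.Ioo a b) (hθ : θ ∈ Set.Ioo a b) {B : ℝ≥0∞}
    (hB : ∀ u ∈ Set.uIcc s θ, glmExpectedCondVar Q μ T u ≤ B) :
    ∫⁻ z, ENNReal.ofReal (glmLogLikelihood μ T s θ z + Real.exp (-glmLogLikelihood μ T s θ z) - 1)
      ∂(glmMeasure Q μ T θ) ≤ ENNReal.ofReal ((θ - s) ^ 2) * B := by
  have hl := measurable_glmLogLikelihood μ hT s θ
  rw [lintegral_glmMeasure Q μ hT θ (by fun_prop)]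
  have hx : ∀ᵐ x ∂Q, ∫⁻ y, ENNReal.ofReal (glmLogLikelihood μ T s θ (x, y)
        + Real.exp (-glmLogLikelihood μ T s θ (x, y)) - 1) ∂(glmCond μ T θ x)
      ≤ ENNReal.ofReal |θ - s|
        * ∫⁻ u in Set.uIoc s θ, evariance (fun y => T y x) (glmCond μ T u x) := by
    -- The exceptional null set may depend on the parameter. Two endpoints suffice: the set of
    -- integrable exponents is convex, so it contains every parameter between them.
    filter_upwards [ha, hb] with x hax hbx
    have hsub : Set.Ioo a b ⊆ interior (integrableExpSet (fun y => T y x) μ) := by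
      rw [← interior_Icc]
      exact interior_mono (convex_integrableExpSet.ordConnected.out hax hbx)
    have huIcc := (Set.ordConnected_Ioo.uIcc_subset hs hθ).trans hsub
    have hcond : ∀ u ∈ Set.uIcc s θ, glmCond μ T u x = μ.tilted fun y => u * T y x := fun u hu =>
      glmCond_eq_tilted hμ <| integrable_of_mem_integrableExpSet <|
        interior_subset (huIcc hu)
    rw [setLIntegral_congr_fun measurableSet_uIoc
      (fun u hu => by simp only [hcond u (Set.uIoc_subset_uIcc hu)]; rfl),
      hcond θ Set.right_mem_uIcc]
    exact lintegral_logLikelihood_tilted_le hμ huIcc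
  refine (lintegral_mono_ae hx).trans ?_
  -- Tonelli: averaging over the covariate first turns the conditional variances into the expected
  -- conditional variance, bounded by `B`.
  rw [lintegral_const_mul' _ _ ENNReal.ofReal_ne_top, lintegral_lintegral_swap
    (f := fun x u => evariance (fun y => T y x) (glmCond μ T u x))
    ((measurable_evariance_glmCond μ hT).comp measurable_swap).aemeasurable]
  calc _ ≤ ENNReal.ofReal |θ - s| * ∫⁻ u in Set.uIoc s θ, B := by
        gcongr ENNReal.ofReal |θ - s| * ?_
        exact setLIntegral_mono' measurableSet_uIoc fun u hu => hB u (Set.uIoc_subset_uIcc hu)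
    _ = ENNReal.ofReal ((θ - s) ^ 2) * B := by
        rw [setLIntegral_const, Real.volume_uIoc, mul_left_comm, mul_comm, ← ENNReal.ofReal_mul
          (abs_nonneg _), abs_mul_abs_self, sq]

/-- The relative entropy of two members of the model is at most the squared parameter distance
times a bound on the expected conditional variance between them. -/
theorem integral_glmLogLikelihood_le (Q : Measure 𝒳) [IsProbabilityMeasure Q] (μ : Measure 𝒴)
    [SigmaFinite μ] (hμ : μ ≠ 0) {T : 𝒴 → 𝒳 → ℝ} (hT : Measurable (Function.uncurry T))
    {a b s θ : ℝ} (ha : ∀ᵐ x ∂Q, Integrable (fun y => Real.exp (a * T y x)) μ)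
    (hb : ∀ᵐ x ∂Q, Integrable (fun y => Real.exp (b * T y x)) μ)
    (hs : s ∈ Set.Ioo a b) (hθ : θ ∈ Set.Ioo a b)
    [IsProbabilityMeasure (glmMeasure Q μ T s)] [IsProbabilityMeasure (glmMeasure Q μ T θ)]
    {B : ℝ} (hB₀ : 0 ≤ B)
    (hB : ∀ u ∈ Set.uIcc s θ, glmExpectedCondVar Q μ T u ≤ ENNReal.ofReal B) :
    Integrable (glmLogLikelihood μ T s θ) (glmMeasure Q μ T θ) ∧
      ∫ z, glmLogLikelihood μ T s θ z ∂(glmMeasure Q μ T θ) ≤ (θ - s) ^ 2 * B := by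
  set P := glmMeasure Q μ T θ
  set l := glmLogLikelihood μ T s θ
  have hl : Measurable l := measurable_glmLogLikelihood μ hT s θ
  have hφ := lintegral_glmLogLikelihood_le Q μ hμ hT ha hb hs hθ hB
  rw [← ENNReal.ofReal_mul (sq_nonneg _)] at hφ
  have hφ₀ : ∀ z, 0 ≤ l z + Real.exp (-l z) - 1 := fun z => by
    have := Real.add_one_le_exp (-l z)
    linarith
  have hφint : Integrable (fun z => l z + Real.exp (-l z) - 1) P := by
    refine ⟨by fun_prop, ?_⟩
    rw [hasFiniteIntegral_iff_ofReal (ae_of_all _ hφ₀)]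
    exact hφ.trans_lt ENNReal.ofReal_lt_top
  have hφle : ∫ z, (l z + Real.exp (-l z) - 1) ∂P ≤ (θ - s) ^ 2 * B := by
    rw [integral_eq_lintegral_of_nonneg_ae (ae_of_all _ hφ₀) hφint.aestronglyMeasurable]
    exact ENNReal.toReal_le_of_le_ofReal (by positivity) hφ
  have hexp : ∫⁻ z, ENNReal.ofReal (Real.exp (-l z)) ∂P = 1 := by
    rw [← Measure.restrict_univ (μ := P), ← withDensity_apply _ .univ,
      ← glmMeasure_eq_withDensity Q μ hT s θ, measure_univ]
  have hexpint : Integrable (fun z => Real.exp (-l z)) P := by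
    refine ⟨by fun_prop, ?_⟩
    rw [hasFiniteIntegral_iff_ofReal (ae_of_all _ fun z => (Real.exp_pos _).le), hexp]
    exact ENNReal.one_lt_top
  have hexp' : ∫ z, Real.exp (-l z) ∂P = 1 := by
    rw [integral_eq_lintegral_of_nonneg_ae (ae_of_all _ fun z => (Real.exp_pos _).le)
      hexpint.aestronglyMeasurable, hexp, ENNReal.toReal_one]
  have hdiff : Integrable (fun z => l z + Real.exp (-l z) - 1 - Real.exp (-l z)) P :=
    hφint.sub hexpint
  -- Integrability of `l` is not known beforehand. It is recovered from the nonnegative `l + exp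
  -- (-l) - 1`, already controlled, and from `exp (-l)`, which has mean one.
  have heq : l = fun z => l z + Real.exp (-l z) - 1 - Real.exp (-l z) + 1 := by
    funext z
    ring
  have hlint : Integrable l P := by
    rw [heq]
    exact hdiff.add (integrable_const 1)
  refine ⟨hlint, ?_⟩
  calc ∫ z, l z ∂P = ∫ z, (l z + Real.exp (-l z) - 1 - Real.exp (-l z) + 1) ∂P := by rw [← heq]
    _ = ∫ z, (l z + Real.exp (-l z) - 1) ∂P := by
      rw [integral_add hdiff (integrable_const 1), integral_sub hφint hexpint, hexp',
        integral_const, probReal_univ, one_smul, sub_add_cancel]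
    _ ≤ _ := hφle

end GLM

/-! ### Packing disjoint events under a common law -/

/-- If a likelihood ratio over `n` observations has expected logarithm at most `n κ`, an event of
probability at least `p` keeps probability at least `exp (-(n κ + 1) / p)` after the change of
measure. -/
theorem ofReal_exp_le_pi {Z : Type*} [MeasurableSpace Z] {P P₀ : Measure Z}
    [IsProbabilityMeasure P] [IsProbabilityMeasure P₀] {l : Z → ℝ} (hl : Measurable l)
    (hP : P₀ = P.withDensity fun z => ENNReal.ofReal (Real.exp (-l z)))
    (hint : Integrable l P) {κ : ℝ} (hκ : ∫ z, l z ∂P ≤ κ) (hκ₀ : 0 ≤ κ) {n : ℕ}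
    {A : Set (Fin n → Z)} (hA : MeasurableSet A) {p : ℝ} (hp : 0 < p)
    (hpA : ENNReal.ofReal p ≤ Measure.pi (fun _ : Fin n => P) A) :
    ENNReal.ofReal (Real.exp (-(n * κ + 1) / p)) ≤ Measure.pi (fun _ : Fin n => P₀) A := by
  -- With `q = exp (-(n κ + 1) / p)`, the entropy inequality would give `n κ + 1 ≤ n κ + log 2`, and
  -- `log 2 < 1`.
  by_contra! hlt
  have h := pi_real_mul_log_le hl hP hint hκ n hA (Real.exp_pos _) hlt.le
  have hpA' : p ≤ (Measure.pi fun _ : Fin n => P).real A :=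
    (ENNReal.ofReal_le_iff_le_toReal (measure_ne_top _ _)).1 hpA
  rw [one_div, Real.log_inv, Real.log_exp, neg_div, neg_neg] at h
  have h' : n * κ + 1 ≤ (Measure.pi fun _ : Fin n => P).real A * ((n * κ + 1) / p) := by
    calc n * κ + 1 = p * ((n * κ + 1) / p) := by field_simp
      _ ≤ _ := by gcongr
  linarith [Real.log_two_lt_d9]

/-- If the parameters `θ k` can be told apart by the estimates at the times `n k`, with probability
at least `p` under each `P k`, then the log-likelihood ratios to a common reference `P₀` cannot all
be small. -/
theorem sum_exp_le_one_of_separated {Z : Type*} [MeasurableSpace Z] {P : ℕ → Measure Z}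
    {P₀ : Measure Z} [∀ k, IsProbabilityMeasure (P k)] [IsProbabilityMeasure P₀]
    {est : (n : ℕ) → (Fin n → Z) → ℝ} (hest : ∀ n, Measurable (est n)) {t : ℕ → ℝ≥0}
    {θ : ℕ → ℝ} {n : ℕ → ℕ} (hn : Monotone n) {p : ℝ} (hp : 0 < p) {N : ℕ}
    (hprob : ∀ k, ENNReal.ofReal p ≤ Measure.infinitePi (fun _ : ℕ => P k)
      {ω | ∀ i ≤ k, |est (n i) (fun m : Fin (n i) => ω m) - θ k| ≤ t (n i)})
    (hsep : ∀ j k, j < k → 2 * (t (n j) : ℝ) < |θ j - θ k|)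
    {l : ℕ → Z → ℝ} (hl : ∀ k, Measurable (l k))
    (hP : ∀ k < N, P₀ = (P k).withDensity fun z => ENNReal.ofReal (Real.exp (-l k z)))
    (hint : ∀ k < N, Integrable (l k) (P k)) {κ : ℕ → ℝ} (hκ₀ : ∀ k, 0 ≤ κ k)
    (hκ : ∀ k < N, ∫ z, l k z ∂(P k) ≤ κ k) :
    ∑ k ∈ Finset.range N, Real.exp (-(n k * κ k + 1) / p) ≤ 1 := by
  set B : ℕ → Set (ℕ → Z) := fun k =>
    {ω | ∀ i ≤ k, |est (n i) (fun m : Fin (n i) => ω m) - θ k| ≤ t (n i)} with hB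
  set A : (k : ℕ) → Set (Fin (n k) → Z) := fun k => {z | ∀ i, ∀ h : i ≤ k,
    |est (n i) (fun m : Fin (n i) => z (Fin.castLE (hn h) m)) - θ k| ≤ t (n i)} with hA
  have hAm : ∀ k, MeasurableSet (A k) := fun k => by
    simp only [hA, Set.ofPred_forall]
    refine MeasurableSet.iInter fun i => MeasurableSet.iInter fun h => ?_
    exact measurableSet_le (((hest (n i)).comp (by fun_prop)).sub_const _).abs measurable_const
  have hBA : ∀ k, B k = (fun (ω : ℕ → Z) (m : Fin (n k)) => ω m) ⁻¹' A k := fun k => rfl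
  have hBm : ∀ k, MeasurableSet (B k) := fun k => by
    rw [hBA]
    exact measurableSet_preimage (by fun_prop) (hAm k)
  have hpi : ∀ (R : Measure Z) [IsProbabilityMeasure R] (k : ℕ),
      Measure.infinitePi (fun _ : ℕ => R) (B k) = Measure.pi (fun _ : Fin (n k) => R) (A k) := by
    intro R _ k
    rw [← infinitePi_map_fin, Measure.map_apply (by fun_prop) (hAm k), hBA]
  -- On both events the estimate at the earlier time `n j` lies within `t (n j)` of `θ j` and of `θ
  -- k`; this is why `B k` also constrains the times before `n k`.
  have hdisj : ∀ j k, j < k → Disjoint (B j) (B k) := fun j k hjk => by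
    refine Set.disjoint_left.2 fun ω hj hk => (hsep j k hjk).not_ge ?_
    have h1 := hj j le_rfl
    have h2 := hk j hjk.le
    rw [abs_le] at h1 h2 ⊢
    constructor <;> linarith
  have hpair : (Finset.range N : Set ℕ).PairwiseDisjoint B := fun j _ k _ hjk =>
    hjk.lt_or_gt.elim (hdisj j k) fun h => (hdisj k j h).symm
  have hsum : ∑ k ∈ Finset.range N, Measure.infinitePi (fun _ : ℕ => P₀) (B k) ≤ 1 := by
    rw [← measure_biUnion_finset hpair fun k _ => hBm k]
    exact prob_le_one
  have hle : ENNReal.ofReal (∑ k ∈ Finset.range N, Real.exp (-(n k * κ k + 1) / p)) ≤ 1 := by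
    rw [ENNReal.ofReal_sum_of_nonneg fun k _ => (Real.exp_pos _).le]
    refine (Finset.sum_le_sum fun k hk => ?_).trans hsum
    have hk' := Finset.mem_range.1 hk
    rw [hpi]
    exact ofReal_exp_le_pi (hl k) (hP k hk') (hint k hk') (hκ k hk') (hκ₀ k) (hAm k) hp
      ((hprob k).trans_eq (hpi _ _))
  simpa using hle

/-! ### Radii along geometric times -/

/-- The radius `√(v log log 64ᵏ / 64ᵏ)` of the law of the iterated logarithm at time `64ᵏ`. -/
noncomputable def lilRadius (v : ℝ) (k : ℕ) : ℝ :=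
  √(v * Real.log (Real.log (64 ^ k)) / 64 ^ k)

theorem two_le_log_pow {k : ℕ} (hk : 2 ≤ k) : 2 ≤ Real.log (64 ^ k) := by
  rw [Real.log_pow]
  have h : 1 ≤ Real.log 64 := by
    rw [Real.le_log_iff_exp_le (by norm_num)]
    linarith [Real.exp_one_lt_d9]
  have hk' : (2 : ℝ) ≤ k := by exact_mod_cast hk
  nlinarith

theorem log_log_pow_pos {k : ℕ} (hk : 2 ≤ k) : 0 < Real.log (Real.log (64 ^ k)) :=
  Real.log_pos (by linarith [two_le_log_pow hk])

theorem log_log_pow_succ_le {k : ℕ} (hk : 2 ≤ k) :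
    Real.log (Real.log (64 ^ (k + 1))) ≤ 2 * Real.log (Real.log (64 ^ k)) := by
  have h2 := two_le_log_pow hk
  have h : Real.log (64 ^ (k + 1)) ≤ Real.log (64 ^ k) ^ 2 := by
    have hk' : (1 : ℝ) ≤ k := by exact_mod_cast one_le_two.trans hk
    have h64 : 0 < Real.log 64 := Real.log_pos (by norm_num)
    calc Real.log (64 ^ (k + 1)) = (k + 1) * Real.log 64 := by rw [Real.log_pow]; push_cast; ring
      _ ≤ 2 * (k * Real.log 64) := by nlinarith
      _ = 2 * Real.log (64 ^ k) := by rw [Real.log_pow]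
      _ ≤ Real.log (64 ^ k) ^ 2 := by nlinarith
  have h0 : 0 < Real.log (64 ^ (k + 1)) := by linarith [two_le_log_pow (hk.trans k.le_succ)]
  calc _ ≤ Real.log (Real.log (64 ^ k) ^ 2) := Real.log_le_log h0 h
    _ = _ := by rw [Real.log_pow]; norm_num

theorem lilRadius_pos {v : ℝ} (hv : 0 < v) {k : ℕ} (hk : 2 ≤ k) : 0 < lilRadius v k := by
  have := log_log_pow_pos hk
  exact Real.sqrt_pos.2 (by positivity)

theorem sq_lilRadius {v : ℝ} (hv : 0 < v) {k : ℕ} (hk : 2 ≤ k) :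
    64 ^ k * lilRadius v k ^ 2 = v * Real.log (Real.log (64 ^ k)) := by
  have := log_log_pow_pos hk
  rw [lilRadius, Real.sq_sqrt (by positivity)]
  field_simp

/-- The iterated logarithm at most doubles while the time grows 64-fold, so the squared radius
shrinks by at least `32`, more than the factor `9` needed. -/
theorem lilRadius_succ_le {v : ℝ} (hv : 0 < v) {k : ℕ} (hk : 2 ≤ k) :
    lilRadius v (k + 1) ≤ lilRadius v k / 3 := by
  have h1 := sq_lilRadius hv hk
  have h2 := sq_lilRadius hv (hk.trans k.le_succ)
  have h3 := mul_le_mul_of_nonneg_left (log_log_pow_succ_le hk) hv.le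
  have h4 : 0 ≤ v * Real.log (Real.log (64 ^ k)) := by
    have := log_log_pow_pos hk
    positivity
  refine abs_le_of_sq_le_sq' ?_ (div_nonneg (lilRadius_pos hv hk).le (by norm_num)) |>.2
  have h5 : 64 ^ k * (64 * lilRadius v (k + 1) ^ 2) ≤ 64 ^ k * (2 * lilRadius v k ^ 2) := by
    calc _ = 64 ^ (k + 1) * lilRadius v (k + 1) ^ 2 := by ring
      _ ≤ 2 * (64 ^ k * lilRadius v k ^ 2) := by rw [h1, h2]; linarith
      _ = _ := by ring
  have h6 := le_of_mul_le_mul_left h5 (by positivity)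
  nlinarith [sq_nonneg (lilRadius v k)]

theorem lilRadius_le_of_lt {v : ℝ} (hv : 0 < v) {j k : ℕ} (hj : 2 ≤ j) (hjk : j < k) :
    lilRadius v k ≤ lilRadius v j / 3 := by
  induction k, hjk using Nat.le_induction with
  | base => exact lilRadius_succ_le hv hj
  | succ k hk ih =>
    have h := lilRadius_succ_le hv (hj.trans (Nat.le_of_succ_le hk))
    have h' := lilRadius_pos hv (hj.trans (Nat.le_of_succ_le hk))
    linarith

theorem tendsto_lilRadius {v : ℝ} (hv : 0 < v) : Tendsto (lilRadius v) atTop (𝓝 0) := by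
  rw [← tendsto_add_atTop_iff_nat 2]
  have hle : ∀ m, lilRadius v (m + 2) ≤ lilRadius v 2 * (1 / 3 : ℝ) ^ m := fun m => by
    induction m with
    | zero => simp
    | succ m ih =>
      have h := lilRadius_succ_le hv (k := m + 2) (by omega)
      rw [show m + 1 + 2 = m + 2 + 1 by ring, pow_succ]
      linarith
  refine squeeze_zero (fun m => (lilRadius_pos hv (by omega)).le) hle ?_
  simpa using (tendsto_pow_atTop_nhds_zero_of_lt_one (r := (1 / 3 : ℝ)) (by norm_num)
    (by norm_num)).const_mul (lilRadius v 2)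

/-! ### Harmonic divergence and one-sided neighbourhoods -/

/-- Shifted partial sums of the harmonic series are unbounded. -/
theorem exists_lt_sum_range_one_div (K : ℕ) (c : ℝ) :
    ∃ N, c < ∑ i ∈ Finset.range N, 1 / ((i + K : ℕ) : ℝ) := by
  by_contra! h
  exact Real.not_summable_one_div_natCast ((summable_nat_add_iff K).1
    (summable_of_sum_range_le (fun i => by positivity) h))

/-- From every point of a nondegenerate interval one can move a little in some direction. -/
theorem exists_direction_of_convex {Θ : Set ℝ} (hΘ : Convex ℝ Θ) (hΘ' : Θ.Nontrivial) {θ₀ : ℝ}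
    (hθ₀ : θ₀ ∈ Θ) {S : Set ℝ} (hS : S ∈ 𝓝[Θ] θ₀) :
    ∃ ε : ℝ, (ε = 1 ∨ ε = -1) ∧ ∃ δ > 0, ∀ s ∈ Set.Icc 0 δ, θ₀ + ε * s ∈ Θ ∩ S := by
  obtain ⟨r, hr, hrS⟩ := Metric.mem_nhdsWithin_iff.1 hS
  obtain ⟨θ₁, hθ₁, hne⟩ := hΘ'.exists_ne θ₀
  have key : ∀ ε : ℝ, (ε = 1 ∨ ε = -1) → (∀ s ∈ Set.Icc 0 |θ₁ - θ₀|, θ₀ + ε * s ∈ Θ) →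
      ∃ δ > 0, ∀ s ∈ Set.Icc 0 δ, θ₀ + ε * s ∈ Θ ∩ S := by
    refine fun ε hε h => ⟨min |θ₁ - θ₀| (r / 2),
      lt_min (abs_pos.2 (sub_ne_zero.2 hne)) (half_pos hr), fun s hs => ?_⟩
    have hsΘ := h s ⟨hs.1, hs.2.trans (min_le_left _ _)⟩
    refine ⟨hsΘ, hrS ⟨?_, hsΘ⟩⟩
    have hs' := hs.2.trans (min_le_right _ _)
    have habs : |ε * s| = s := by rcases hε with rfl | rfl <;> simp [abs_of_nonneg hs.1]
    rw [Metric.mem_ball, Real.dist_eq, add_sub_cancel_left, habs]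
    linarith
  rcases hne.lt_or_gt with h | h
  · refine ⟨-1, Or.inr rfl, key _ (Or.inr rfl) fun s hs => hΘ.ordConnected.out hθ₁ hθ₀ ?_⟩
    rw [abs_of_neg (by linarith)] at hs
    exact ⟨by linarith [hs.2], by linarith [hs.1]⟩
  · refine ⟨1, Or.inl rfl, key _ (Or.inl rfl) fun s hs => hΘ.ordConnected.out hθ₀ hθ₁ ?_⟩
    rw [abs_of_pos (by linarith)] at hs
    exact ⟨by linarith [hs.1], by linarith [hs.2]⟩

/-! ### The lower bound -/

theorem mainTheorem8 {𝒳 𝒴 : Type*} [MeasurableSpace 𝒳] [MeasurableSpace 𝒴]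
    (Q : Measure 𝒳) [IsProbabilityMeasure Q] (μ : Measure 𝒴) [SigmaFinite μ]
    (T : 𝒴 → 𝒳 → ℝ) (hT : Measurable (Function.uncurry T))
    -- the parameter set: a nondegenerate interval on which the model is defined
    (Θ : Set ℝ) (hΘ : Convex ℝ Θ) (hΘ' : Θ.Nontrivial)
    (hA : ∀ θ ∈ Θ, ∀ᵐ x ∂Q, Integrable (fun y => Real.exp (θ * T y x)) μ)
    (θ₀ : ℝ) (hθ₀ : θ₀ ∈ Θ)
    -- the expected conditional variance is finite and continuous near `θ₀`
    (U : Set ℝ) (hU : U ∈ 𝓝 θ₀)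
    (hfin : ∀ θ ∈ U ∩ Θ, glmExpectedCondVar Q μ T θ < ∞)
    (hcont : ContinuousOn (glmExpectedCondVar Q μ T) (U ∩ Θ))
    (hpos : 0 < glmExpectedCondVar Q μ T θ₀)
    (α : ℝ) (hα : α ∈ Set.Icc (0 : ℝ) 1) (t : ℕ → ℝ≥0)
    (est : (n : ℕ) → (Fin n → 𝒳 × 𝒴) → ℝ)
    (hest : IsTimeUniformEstimator (fun θ : Θ => glmMeasure Q μ T (θ : ℝ)) (fun θ : Θ => (θ : ℝ))
      α t est) :
    ∃ᶠ n : ℕ in atTop,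
      (1 / 4 : ℝ) * √((1 - α) * Real.log (Real.log n) /
        ((glmExpectedCondVar Q μ T θ₀).toReal * n)) ≤ t n := by

  rcases hα.2.eq_or_lt with rfl | hα1
  -- For `α = 1` the claimed bound is zero; otherwise `1 - α` may be divided by.
  · exact Frequently.of_forall fun n => by simp
  set M : ℝ := (glmExpectedCondVar Q μ T θ₀).toReal with hMdef
  have hfin₀ := hfin θ₀ ⟨mem_of_mem_nhds hU, hθ₀⟩
  have hM : 0 < M := ENNReal.toReal_pos hpos.ne' hfin₀.ne
  have hμ : μ ≠ 0 := by
    rintro rfl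
    simp [glmExpectedCondVar, glmCond, evariance] at hpos
  have hp : 0 < 1 - α := by linarith
  have hv : 0 < (1 - α) / M := by positivity
  -- a one-sided neighbourhood of `θ₀` where the variance is at most `3 M / 2`
  have hS : {θ | glmExpectedCondVar Q μ T θ < ENNReal.ofReal (3 / 2 * M)} ∈ 𝓝[Θ] θ₀ := by
    have h := (hcont θ₀ ⟨mem_of_mem_nhds hU, hθ₀⟩).eventually_lt_const
      (show glmExpectedCondVar Q μ T θ₀ < ENNReal.ofReal (3 / 2 * M) by
        rw [← ENNReal.ofReal_toReal hfin₀.ne]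
        exact (ENNReal.ofReal_lt_ofReal_iff (by positivity)).2 (by rw [← hMdef]; linarith))
    rwa [nhdsWithin_inter_of_mem (mem_nhdsWithin_of_mem_nhds hU)] at h
  obtain ⟨ε, hε, δ, hδ, hseg⟩ := exists_direction_of_convex hΘ hΘ' hθ₀ hS
  by_contra hcon
  rw [not_frequently] at hcon
  have hpow : Tendsto (fun k : ℕ => 64 ^ k) atTop (atTop : Filter ℕ) :=
    tendsto_pow_atTop_atTop_of_one_lt (by norm_num)
  obtain ⟨K, hK⟩ := eventually_atTop.1 ((hpow.eventually hcon).and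
    ((tendsto_lilRadius hv).eventually_lt_const hδ |>.and (eventually_ge_atTop 2)))
  have hK2 : ∀ i : ℕ, 2 ≤ i + K := fun i => (hK _ (Nat.le_add_left K i)).2.2
  set s : ℕ → ℝ := fun i => lilRadius ((1 - α) / M) (i + K) with hs
  have hs0 : ∀ i, 0 < s i := fun i => lilRadius_pos hv (hK2 i)
  have hsδ : ∀ i, s i < δ := fun i => (hK _ (Nat.le_add_left K i)).2.1
  have hslt : ∀ i j, i < j → s j ≤ s i / 3 := fun i j hij =>
    lilRadius_le_of_lt hv (hK2 i) (by omega)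
  have hts : ∀ i, (t (64 ^ (i + K)) : ℝ) < s i / 4 := fun i => by
    refine (not_le.1 (hK _ (Nat.le_add_left K i)).1).trans_eq ?_
    simp only [hs, lilRadius, Nat.cast_pow, Nat.cast_ofNat]
    rw [div_mul_eq_mul_div (1 - α), div_div, one_div, div_eq_inv_mul _ (4 : ℝ)]
  -- The factor `3/4` meets two demands. Since `s j ≤ s i / 3` for `i < j`, distances are at least
  -- `(3/4) (2/3) s i = s i / 2 > 2 t`; and the entropy constant `(3/4)² (3/2) = 27/32` stays below
  -- `1`.
  set θ : ℕ → ℝ := fun i => θ₀ + ε * (3 / 4 * s i) with hθ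
  have hθΘ : ∀ i, θ i ∈ Θ := fun i =>
    (hseg _ ⟨by linarith [hs0 i], by linarith [hs0 i, hsδ i]⟩).1
  have hdist : ∀ i j, |θ i - θ j| = 3 / 4 * |s i - s j| := fun i j => by
    have h : θ i - θ j = ε * (3 / 4 * (s i - s j)) := by simp only [hθ]; ring
    rw [h, abs_mul, abs_mul]
    rcases hε with rfl | rfl <;> norm_num
  have hprobm : ∀ i, IsProbabilityMeasure (glmMeasure Q μ T (θ i)) := fun i =>
    isProbabilityMeasure_glmMeasure Q μ hμ hT (hA _ (hθΘ i))
  -- the end points of the segment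
  set a := min θ₀ (θ₀ + ε * δ) with ha
  set b := max θ₀ (θ₀ + ε * δ) with hb
  have hendΘ : θ₀ + ε * δ ∈ Θ := (hseg δ ⟨hδ.le, le_rfl⟩).1
  have haΘ : a ∈ Θ := by rcases min_choice θ₀ (θ₀ + ε * δ) with h | h <;> rwa [ha, h]
  have hbΘ : b ∈ Θ := by rcases max_choice θ₀ (θ₀ + ε * δ) with h | h <;> rwa [hb, h]
  -- All `θ i` lie strictly inside, hence in the interior of the set of integrable exponents for
  -- almost every `x`. `θ₀` may be an endpoint of `Θ`, so the reference law below is taken at `θ N`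
  -- instead.
  have hθab : ∀ i, θ i ∈ Set.Ioo a b := fun i => by
    have h1 := hs0 i
    have h2 := hsδ i
    rcases hε with rfl | rfl
    · exact ⟨min_lt_of_left_lt (by simp only [hθ]; linarith),
        lt_max_of_lt_right (by simp only [hθ]; linarith)⟩
    · exact ⟨min_lt_of_right_lt (by simp only [hθ]; linarith),
        lt_max_of_lt_left (by simp only [hθ]; linarith)⟩
  have hG : ∀ i j, ∀ u ∈ Set.uIcc (θ i) (θ j),
      glmExpectedCondVar Q μ T u ≤ ENNReal.ofReal (3 / 2 * M) := fun i j u hu => by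
    have hu' := Set.ordConnected_Ioo.uIcc_subset (hθab i) (hθab j) hu
    have hw : ∃ w ∈ Set.Icc 0 δ, θ₀ + ε * w = u := by
      rcases hε with rfl | rfl
      · rw [ha, hb, min_eq_left (by linarith), max_eq_right (by linarith)] at hu'
        exact ⟨u - θ₀, ⟨by linarith [hu'.1], by linarith [hu'.2]⟩, by ring⟩
      · rw [ha, hb, min_eq_right (by linarith), max_eq_left (by linarith)] at hu'
        exact ⟨θ₀ - u, ⟨by linarith [hu'.2], by linarith [hu'.1]⟩, by ring⟩
    obtain ⟨w, hw, rfl⟩ := hw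
    exact (hseg w hw).2.le
  have hKL : ∀ i j, i < j → Integrable (glmLogLikelihood μ T (θ j) (θ i)) (glmMeasure Q μ T (θ i)) ∧
      ∫ z, glmLogLikelihood μ T (θ j) (θ i) z ∂(glmMeasure Q μ T (θ i))
        ≤ (3 / 4 * s i) ^ 2 * (3 / 2 * M) := fun i j hij => by
    have h := integral_glmLogLikelihood_le Q μ hμ hT (hA a haΘ) (hA b hbΘ) (hθab j) (hθab i)
      (B := 3 / 2 * M) (by positivity) (hG j i)
    refine ⟨h.1, h.2.trans ?_⟩
    have h3 := hslt i j hij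
    have h4 := hs0 i
    have h5 := hs0 j
    rw [← sq_abs, hdist, abs_of_pos (by linarith)]
    gcongr <;> linarith
  have hsum : ∀ N, ∑ k ∈ Finset.range N,
      Real.exp (-((64 ^ (k + K) : ℕ) * ((3 / 4 * s k) ^ 2 * (3 / 2 * M)) + 1) / (1 - α)) ≤ 1 := by
    intro N
    refine sum_exp_le_one_of_separated (P := fun k => glmMeasure Q μ T (θ k))
      (P₀ := glmMeasure Q μ T (θ N)) hest.1 (t := t) (θ := θ) (n := fun k => 64 ^ (k + K))
      (fun i j hij => Nat.pow_le_pow_right (by norm_num) (by omega)) hp (fun k => ?_)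
      (fun j k hjk => ?_) (l := fun k => glmLogLikelihood μ T (θ N) (θ k))
      (fun k => measurable_glmLogLikelihood μ hT _ _)
      (fun k _ => glmMeasure_eq_withDensity Q μ hT _ _) (fun k hk => (hKL k N hk).1)
      (κ := fun k => (3 / 4 * s k) ^ 2 * (3 / 2 * M)) (fun k => by positivity)
      (fun k hk => (hKL k N hk).2)
    -- The time-uniform event constrains all times `n ≥ 1`, in particular the finitely many in the
    -- packing event.
    · refine (hest.2 ⟨θ k, hθΘ k⟩).trans (measure_mono fun ω hω i _ => ?_)
      exact hω _ (Nat.one_le_pow _ _ (by norm_num))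
    · rw [hdist, abs_of_pos (by linarith [hslt j k hjk, hs0 j])]
      linarith [hslt j k hjk, hts j]
  -- the summands dominate a multiple of the harmonic series
  have h64 : 0 < Real.log 64 := Real.log_pos (by norm_num)
  set C : ℝ := Real.exp (-1 / (1 - α)) / Real.log 64 with hC
  have hC0 : 0 < C := by positivity
  have hterm : ∀ k, C * (1 / ((k + K : ℕ) : ℝ)) ≤
      Real.exp (-((64 ^ (k + K) : ℕ) * ((3 / 4 * s k) ^ 2 * (3 / 2 * M)) + 1) / (1 - α)) :=
    fun k => by
    have hsq := sq_lilRadius hv (hK2 k)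
    have hL := log_log_pow_pos (hK2 k)
    have hlog := two_le_log_pow (hK2 k)
    set L := Real.log (Real.log (64 ^ (k + K))) with hLdef
    -- The factor `1 - α` in the squared radius cancels the division by the probability `1 - α`, and
    -- `M` cancels likewise.
    have h1 : -((64 ^ (k + K) : ℕ) * ((3 / 4 * s k) ^ 2 * (3 / 2 * M)) + 1) / (1 - α)
        = -(27 / 32) * L + -1 / (1 - α) := by
      have h2 : ((64 ^ (k + K) : ℕ) : ℝ) * ((3 / 4 * s k) ^ 2 * (3 / 2 * M))
          = 27 / 32 * M * (64 ^ (k + K) * s k ^ 2) := by push_cast; ring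
      rw [h2, hs, hsq]
      field_simp
      ring
    rw [h1]
    calc C * (1 / ((k + K : ℕ) : ℝ)) = Real.exp (-L) * Real.exp (-1 / (1 - α)) := by
          rw [Real.exp_neg, hLdef, Real.exp_log (by linarith), Real.log_pow, hC]
          field_simp
      _ = Real.exp (-L + -1 / (1 - α)) := (Real.exp_add _ _).symm
      _ ≤ _ := Real.exp_le_exp.2 (by linarith)
  obtain ⟨N, hN⟩ := exists_lt_sum_range_one_div K (1 / C)
  have h := (Finset.sum_le_sum fun k (_ : k ∈ Finset.range N) => hterm k).trans (hsum N)
  rw [← Finset.mul_sum] at h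
  rw [div_lt_iff₀ hC0] at hN
  linarith
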